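/- A real or complex Banach space $X$ with closed unit ball $B_X=\{x\in X:\|x\|\le 1\}$ is said to have property (co) if for every $n\in\mathbb{N}$, all $x_1,\dots,x_n\in B_X$, all real $\lambda_1,\dots,\lambda_n>0$ with $\sum_{i=1}^n\lambda_i=1$ and every $\varepsilon>0$, putting $x_0=\sum_{i=1}^n\lambda_i x_i$, there exist $\delta>0$ and norm-continuous functions $$\Phi_i: B(x_0,\delta)\cap B_X\to B(x_i,\varepsilon)\cap B_X\qquad (i=1,\dots,n)$$ such that $y=\sum_{i=1}^n\lambda_i\Phi_i(y)$ for every $y\in B(x_0,\delta)\cap B_X$. Here $B(x,r)=\{z\in X:\|z-x\|<r\}$. **Theorem.** Every finite-dimensional (complex) C$^*$-algebra has property (co). -/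

import Mathlib

/-- Property (co) of a normed space `X`. The closed unit ball `B_X` is `Metric.closedBall 0 1`,
and a continuous function `Φ i` defined on `B(x₀, δ) ∩ B_X` is given by a function on `X` that is
continuous on that set. -/
def PropertyCO (X : Type*) [NormedAddCommGroup X] [NormedSpace ℝ X] : Prop :=
  ∀ (n : ℕ) (x : Fin n → X) (l : Fin n → ℝ) (ε : ℝ),
    (∀ i, x i ∈ Metric.closedBall (0 : X) 1) → (∀ i, 0 < l i) → ∑ i, l i = 1 → 0 < ε →
    ∃ δ : ℝ, 0 < δ ∧ ∃ Φ : Fin n → X → X,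
      (∀ i, ContinuousOn (Φ i)
        (Metric.ball (∑ j, l j • x j) δ ∩ Metric.closedBall (0 : X) 1)) ∧
      (∀ i, Set.MapsTo (Φ i)
        (Metric.ball (∑ j, l j • x j) δ ∩ Metric.closedBall (0 : X) 1)
        (Metric.ball (x i) ε ∩ Metric.closedBall (0 : X) 1)) ∧
      ∀ y ∈ Metric.ball (∑ j, l j • x j) δ ∩ Metric.closedBall (0 : X) 1,
        y = ∑ i, l i • Φ i y

/-! Write x₀ for the convex combination and let k, h be the spectral projections of x₀x₀* and x₀*x₀
away from the eigenvalue 1. The variance identity Σ λⱼ(xⱼ - x₀)(xⱼ - x₀)* ≤ 1 - x₀x₀* and its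
adjoint form force xᵢ - x₀ into the corner k·h (`mul_sub_convex_combination_eq_zero`), where ‖k x₀‖
< 1 because a finite spectrum has a gap below 1. For y near x₀ in the ball, continuous functional
calculus gives projections K(y), H(y) with K(y)y = yH(y), so y is block diagonal and its corner can
be moved independently (`norm_add_corner_le_one`). Take Φᵢ(y) = y + (1-t)K(y)(xᵢ - x₀)H(y). The
corrections average to zero by linearity, and a small t > 0 makes the corner norm strictly below 1
at x₀, hence at most 1 nearby. -/

open Filter Topology Metric

/-! ### Scalar cutoffs across a spectral gap -/

section Cutoff

/-- The continuous function equal to `1` on `(-∞, (2r+1)/3]`, to `0` on `[(r+2)/3, ∞)`, and affine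
in between. -/
noncomputable def gapCutoff (r s : ℝ) : ℝ := max 0 (min 1 ((r + 2 - 3 * s) / (1 - r)))

theorem continuous_gapCutoff (r : ℝ) : Continuous (gapCutoff r) := by
  unfold gapCutoff
  fun_prop

theorem gapCutoff_eq_one {r s : ℝ} (hr : r < 1) (hs : s ≤ (2 * r + 1) / 3) :
    gapCutoff r s = 1 := by
  have : 1 ≤ (r + 2 - 3 * s) / (1 - r) := by
    rw [le_div_iff₀ (by linarith)]
    linarith
  simp [gapCutoff, min_eq_left this]

theorem gapCutoff_eq_zero {r s : ℝ} (hr : r < 1) (hs : (r + 2) / 3 ≤ s) :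
    gapCutoff r s = 0 := by
  have : (r + 2 - 3 * s) / (1 - r) ≤ 0 :=
    div_nonpos_of_nonpos_of_nonneg (by linarith) (by linarith)
  exact max_eq_left ((min_le_right _ _).trans this)

theorem gapCutoff_mul_self {r s : ℝ} (hr : r < 1) (hs : s ≤ (2 * r + 1) / 3 ∨ (r + 2) / 3 ≤ s) :
    gapCutoff r s * gapCutoff r s = gapCutoff r s := by
  rcases hs with hs | hs
  · simp [gapCutoff_eq_one hr hs]
  · simp [gapCutoff_eq_zero hr hs]

/-- On the middle third of [r, 1] the parabola (s - r)(1 - s) is smallest at the endpoints, with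
value (1/3)(2/3)(1 - r)². -/
theorem le_or_le_of_gap_bump_lt {r s : ℝ}
    (hs : max 0 ((s - r) * (1 - s)) < 2 / 9 * (1 - r) ^ 2) :
    s ≤ (2 * r + 1) / 3 ∨ (r + 2) / 3 ≤ s := by
  by_contra! h
  have := (le_max_right _ _).trans_lt hs
  nlinarith [mul_pos (sub_pos.2 h.1) (sub_pos.2 h.2)]

end Cutoff

theorem Set.Finite.exists_gap_below_one {S : Set ℝ} (hS : S.Finite) :
    ∃ r : ℝ, 0 ≤ r ∧ r < 1 ∧ ∀ s ∈ S, s < 1 → s ≤ r := by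
  have hT : (insert 0 (S ∩ Set.Iio 1)).Finite := (hS.inter_of_left _).insert 0
  obtain ⟨r, hr, hmax⟩ := Set.exists_max_image _ id hT ⟨0, Set.mem_insert _ _⟩
  refine ⟨r, hmax 0 (Set.mem_insert _ _), ?_, fun s hs h1 ↦ hmax s (Or.inr ⟨hs, h1⟩)⟩
  rcases hr with rfl | hr
  · exact zero_lt_one
  · exact hr.2

theorem spectrum.finite_of_finiteDimensional {K B : Type*} [Field K] [Ring B] [Algebra K B]
    [FiniteDimensional K B] (a : B) : (spectrum K a).Finite := by
  nontriviality B
  have hint : IsIntegral K a := Algebra.IsIntegral.isIntegral a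
  refine ((minpoly K a).rootSet_finite K).subset fun s hs ↦ ?_
  have := spectrum.subset_polynomial_aeval a (minpoly K a) ⟨s, hs, rfl⟩
  rw [minpoly.aeval, spectrum.zero_eq, Set.mem_singleton_iff] at this
  rw [Polynomial.mem_rootSet]
  exact ⟨minpoly.ne_zero hint, by simpa using this⟩

/-! ### Functional calculus and order inequalities for contractions -/

section CStar

variable {B : Type*} [CStarAlgebra B]

theorem mul_aeval_star_mul_self (y : B) (q : Polynomial ℝ) :
    y * Polynomial.aeval (star y * y) q = Polynomial.aeval (y * star y) q * y := by
  have h : SemiconjBy y (star y * y) (y * star y) := by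
    simp [SemiconjBy, mul_assoc]
  induction q using Polynomial.induction_on' with
  | add p q hp hq => simp [mul_add, add_mul, hp, hq]
  | monomial n c =>
    simp only [Polynomial.aeval_monomial]
    rw [← mul_assoc, ← Algebra.commutes, mul_assoc, mul_assoc, (h.pow_right n).eq]

/-- Both spectra are finite, so a single interpolation polynomial replaces f on their union and the
polynomial case applies. -/
theorem mul_cfc_star_mul_self [FiniteDimensional ℂ B] (y : B) (f : ℝ → ℝ) :
    y * cfc f (star y * y) = cfc f (y * star y) * y := by
  have : FiniteDimensional ℝ B := FiniteDimensional.complexToReal B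
  have hS := (spectrum.finite_of_finiteDimensional (K := ℝ) (star y * y)).union
    (spectrum.finite_of_finiteDimensional (K := ℝ) (y * star y))
  have hq : ∀ s ∈ spectrum ℝ (star y * y) ∪ spectrum ℝ (y * star y),
      f s = (Lagrange.interpolate hS.toFinset id f).eval s := fun s hs ↦
    (Lagrange.eval_interpolate_at_node (v := id) f Function.injective_id.injOn
      (hS.mem_toFinset.2 hs)).symm
  rw [cfc_congr (fun s hs ↦ hq s (Or.inl hs)), cfc_congr (fun s hs ↦ hq s (Or.inr hs)),
    cfc_polynomial _ _ (IsSelfAdjoint.star_mul_self y),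
    cfc_polynomial _ _ (IsSelfAdjoint.mul_star_self y), mul_aeval_star_mul_self]

theorem spectrum_mul_star_self_subset_Icc {y : B} (hy : ‖y‖ ≤ 1) :
    spectrum ℝ (y * star y) ⊆ Set.Icc 0 1 := by
  let _ := CStarAlgebra.spectralOrder B
  have := CStarAlgebra.spectralOrderedRing B
  intro s hs
  refine ⟨spectrum_nonneg_of_nonneg (mul_star_self_nonneg y) hs, ?_⟩
  rcases subsingleton_or_nontrivial B
  · simp at hs
  calc s ≤ ‖s‖ := le_abs_self s
    _ ≤ ‖y * star y‖ := spectrum.norm_le_norm_of_mem hs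
    _ = ‖y‖ * ‖y‖ := CStarRing.norm_self_mul_star
    _ ≤ 1 := mul_le_one₀ hy (norm_nonneg _) hy

theorem continuousOn_cfc_mul_star_self {f : ℝ → ℝ} (hf : Continuous f) :
    ContinuousOn (fun y : B ↦ cfc f (y * star y)) (closedBall 0 1) := by
  refine ContinuousOn.cfc' (s := Set.Icc 0 1) isCompact_Icc f (by fun_prop) (fun y hy ↦ ?_)
    (fun y _ ↦ IsSelfAdjoint.mul_star_self y) hf.continuousOn
  exact spectrum_mul_star_self_subset_Icc (by simpa using hy)

/-- Elements of the unit ball with orthogonal left supports and orthogonal right supports have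
their sum in the unit ball. -/
theorem norm_add_le_one_of_orthogonal_supports {f u v : B} (hf : IsStarProjection f)
    (huf : u * f = 0) (hvf : v * f = v) (huv : star u * v = 0) (hu : ‖u‖ ≤ 1) (hv : ‖v‖ ≤ 1) :
    ‖u + v‖ ≤ 1 := by
  let _ := CStarAlgebra.spectralOrder B
  have := CStarAlgebra.spectralOrderedRing B
  have key : ∀ {w : B}, ‖w‖ ≤ 1 → star w * w ≤ 1 := fun {w} hw ↦ by
    rw [← CStarAlgebra.norm_le_one_iff_of_nonneg _ (star_mul_self_nonneg w),
      CStarRing.norm_star_mul_self]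
    exact mul_le_one₀ hw (norm_nonneg _) hw
  have conj : ∀ {w g : B}, IsStarProjection g → w * g = w → ‖w‖ ≤ 1 → star w * w ≤ g := by
    intro w g hg hwg hw
    have h1 := star_left_conjugate_le_conjugate (key hw) g
    have h2 : star g * (star w * w) * g = star w * w := by
      rw [mul_assoc, mul_assoc, hwg, ← mul_assoc, ← star_mul, hwg]
    rwa [h2, mul_one, hg.isSelfAdjoint.star_eq, hg.isIdempotentElem.eq] at h1
  have hvu : star v * u = 0 := by simpa using congrArg star huv
  have h1 : star (u + v) * (u + v) ≤ 1 := by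
    have h2 : star (u + v) * (u + v) = star u * u + star v * v := by
      simp [add_mul, mul_add, huv, hvu]
    -- The cross terms vanish, and u*u ≤ 1 - f and v*v ≤ f add up to 1.
    have h3 := add_le_add (conj hf.one_sub (by simp [mul_sub, huf]) hu) (conj hf hvf hv)
    rw [h2]
    simpa using h3
  rw [← CStarAlgebra.norm_le_one_iff_of_nonneg _ (star_mul_self_nonneg _),
    CStarRing.norm_star_mul_self] at h1
  nlinarith [norm_nonneg (u + v)]

/-- If `p` is supported where a convex combination `x₀` of contractions satisfies
`x₀ x₀* = 1`, then `p` annihilates the differences with `x₀`. -/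
theorem mul_sub_convex_combination_eq_zero {n : ℕ} {x : Fin n → B} {l : Fin n → ℝ} {p : B}
    (hx : ∀ i, ‖x i‖ ≤ 1) (hl : ∀ i, 0 < l i) (hsum : ∑ i, l i = 1)
    (hp : p * (1 - (∑ j, l j • x j) * star (∑ j, l j • x j)) * star p = 0) (i : Fin n) :
    p * (x i - ∑ j, l j • x j) = 0 := by
  let _ := CStarAlgebra.spectralOrder B
  have := CStarAlgebra.spectralOrderedRing B
  set x₀ := ∑ j, l j • x j with hx₀
  have hle : ∀ j, x j * star (x j) ≤ 1 := fun j ↦ by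
    rw [← CStarAlgebra.norm_le_one_iff_of_nonneg _ (mul_star_self_nonneg _),
      CStarRing.norm_self_mul_star]
    exact mul_le_one₀ (hx j) (norm_nonneg _) (hx j)
  -- Variance identity: the mean of the squared deviations is the mean square minus the square of
  -- the mean.
  have hid : ∑ j, l j • ((x j - x₀) * star (x j - x₀)) =
      ∑ j, l j • (x j * star (x j)) - x₀ * star x₀ := by
    have h1 : ∑ j, l j • (x j * star x₀) = x₀ * star x₀ := by
      simp_rw [← smul_mul_assoc, ← Finset.sum_mul, ← hx₀]
    have h2 : ∑ j, l j • (x₀ * star (x j)) = x₀ * star x₀ := by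
      have h3 : star x₀ = ∑ j, l j • star (x j) := by simp [hx₀, star_sum, star_smul]
      simp_rw [← mul_smul_comm, ← Finset.mul_sum, ← h3]
    have h3 : ∑ j, l j • (x₀ * star x₀) = x₀ * star x₀ := by
      rw [← Finset.sum_smul, hsum, one_smul]
    simp only [star_sub, sub_mul, mul_sub, smul_sub, Finset.sum_sub_distrib, h1, h2, h3]
    abel
  have hbound : ∑ j, l j • ((x j - x₀) * star (x j - x₀)) ≤ 1 - x₀ * star x₀ := by
    rw [hid]
    refine sub_le_sub_right ?_ _
    calc ∑ j, l j • (x j * star (x j)) ≤ ∑ j, l j • (1 : B) :=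
          Finset.sum_le_sum fun j _ ↦ smul_le_smul_of_nonneg_left (hle j) (hl j).le
      _ = 1 := by rw [← Finset.sum_smul, hsum, one_smul]
  -- Conjugation by p kills the upper bound, so a sum of positive terms is zero and each term
  -- vanishes.
  have hconj := star_right_conjugate_le_conjugate hbound p
  rw [hp] at hconj
  have hterm : ∀ j, 0 ≤ l j • ((p * (x j - x₀)) * star (p * (x j - x₀))) := fun j ↦
    smul_nonneg (hl j).le (mul_star_self_nonneg _)
  have hexp : p * (∑ j, l j • ((x j - x₀) * star (x j - x₀))) * star p =
      ∑ j, l j • ((p * (x j - x₀)) * star (p * (x j - x₀))) := by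
    simp only [Finset.mul_sum, Finset.sum_mul, mul_smul_comm, smul_mul_assoc, star_mul, mul_assoc]
  rw [hexp] at hconj
  have hzero := (Finset.sum_eq_zero_iff_of_nonneg fun j _ ↦ hterm j).1
    (le_antisymm hconj (Finset.sum_nonneg fun j _ ↦ hterm j)) i (Finset.mem_univ i)
  rw [smul_eq_zero_iff_right (hl i).ne'] at hzero
  exact (CStarRing.mul_star_self_eq_zero_iff _).1 hzero

end CStar

/-! ### Spectral projections near x₀ and the corner correction -/

section Correction

variable {B : Type*} [CStarAlgebra B]

theorem isStarProjection_cfc {f : ℝ → ℝ} {a : B} (hf : Continuous f)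
    (h : ∀ s ∈ spectrum ℝ a, f s * f s = f s) : IsStarProjection (cfc f a) where
  isIdempotentElem := by
    rw [IsIdempotentElem, ← cfc_mul f f a hf.continuousOn hf.continuousOn]
    exact cfc_congr h
  isSelfAdjoint := cfc_predicate f a

/-- For a partial isometry-like splitting of `y` by projections `k`, `h` with `k y = y h`,
perturbing the corner `k y h` inside the unit ball keeps `y` in the unit ball. -/
theorem norm_add_corner_le_one {k h y w : B} (hk : IsStarProjection k) (hh : IsStarProjection h)
    (hky : k * y = y * h) (hy : ‖y‖ ≤ 1) (hw : ‖k * y * h + k * w * h‖ ≤ 1) :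
    ‖y + k * w * h‖ ≤ 1 := by
  have hh' := hh.isIdempotentElem.eq
  have hsplit : y + k * w * h = (1 - k) * y * (1 - h) + (k * y * h + k * w * h) := by
    have h1 : k * y * h = y * h := by rw [hky, mul_assoc, hh']
    have h2 : (1 - k) * y * (1 - h) = y - y * h - k * y + k * y * h := by noncomm_ring
    rw [h2, h1, hky]
    abel
  rw [hsplit]
  refine norm_add_le_one_of_orthogonal_supports hh ?_ ?_ ?_ ?_ hw
  · rw [mul_assoc, hh.isIdempotentElem.one_sub_mul_self, mul_zero]
  · rw [add_mul, mul_assoc _ h h, mul_assoc _ h h, hh']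
  · have : star ((1 - k) * y * (1 - h)) * k = 0 := by
      rw [star_mul, star_mul, star_sub, star_sub, star_one, hk.isSelfAdjoint.star_eq, mul_assoc,
        mul_assoc, hk.isIdempotentElem.one_sub_mul_self, mul_zero, mul_zero]
    rw [mul_add, mul_assoc k y, mul_assoc k w, ← mul_assoc _ k, ← mul_assoc _ k, this]
    simp
  · calc ‖(1 - k) * y * (1 - h)‖ ≤ ‖1 - k‖ * ‖y‖ * ‖1 - h‖ := norm_mul₃_le
      _ ≤ 1 * 1 * 1 := by
        gcongr
        exacts [hk.one_sub.norm_le, hh.one_sub.norm_le]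
      _ = 1 := by norm_num

/-- The spectral cutoff of `y y*` at the gap `(r, 1)`. -/
noncomputable def leftCutoff (r : ℝ) (y : B) : B := cfc (gapCutoff r) (y * star y)

theorem continuousOn_leftCutoff (r : ℝ) :
    ContinuousOn (leftCutoff (B := B) r) (closedBall 0 1) :=
  continuousOn_cfc_mul_star_self (continuous_gapCutoff r)

theorem continuousOn_leftCutoff_star (r : ℝ) :
    ContinuousOn (fun y : B ↦ leftCutoff r (star y)) (closedBall 0 1) :=
  (continuousOn_leftCutoff r).comp continuous_star.continuousOn fun y hy ↦ by simpa using hy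

theorem leftCutoff_mul [FiniteDimensional ℂ B] (r : ℝ) (y : B) :
    leftCutoff r y * y = y * leftCutoff r (star y) := by
  simp [leftCutoff, mul_cfc_star_mul_self]

theorem isStarProjection_leftCutoff {r : ℝ} (hr : r < 1) {y : B}
    (h : ∀ s ∈ spectrum ℝ (y * star y), s ≤ (2 * r + 1) / 3 ∨ (r + 2) / 3 ≤ s) :
    IsStarProjection (leftCutoff r y) :=
  isStarProjection_cfc (continuous_gapCutoff r) fun s hs ↦ gapCutoff_mul_self hr (h s hs)

theorem le_or_eq_one_of_gap {r : ℝ} {y : B} (hy : ‖y‖ ≤ 1)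
    (h : ∀ s ∈ spectrum ℝ (y * star y), s < 1 → s ≤ r) {s : ℝ} (hs : s ∈ spectrum ℝ (y * star y)) :
    s ≤ r ∨ s = 1 :=
  ((spectrum_mul_star_self_subset_Icc hy hs).2.lt_or_eq).imp_left (h s hs)

theorem isStarProjection_leftCutoff_of_gap {r : ℝ} (hr : r < 1) {y : B} (hy : ‖y‖ ≤ 1)
    (h : ∀ s ∈ spectrum ℝ (y * star y), s < 1 → s ≤ r) : IsStarProjection (leftCutoff r y) :=
  isStarProjection_leftCutoff hr fun s hs ↦ by
    rcases le_or_eq_one_of_gap hy h hs with h1 | h1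
    · left; linarith
    · right; linarith

/-- A bump supported on the gap [r, 1] has zero functional calculus at y₀, hence small norm nearby.
This keeps the nearby spectra out of the middle third, where alone the cutoff is not 0 or 1. -/
theorem eventually_isStarProjection_leftCutoff {r : ℝ} (hr : r < 1) {y₀ : B} (hy : ‖y₀‖ ≤ 1)
    (h : ∀ s ∈ spectrum ℝ (y₀ * star y₀), s < 1 → s ≤ r) :
    ∀ᶠ y in 𝓝[closedBall 0 1] y₀, IsStarProjection (leftCutoff r y) := by
  set β : ℝ → ℝ := fun s ↦ max 0 ((s - r) * (1 - s)) with hβ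
  have hβc : Continuous β := by fun_prop
  have hc := (continuousOn_cfc_mul_star_self (B := B) hβc).norm y₀ (by simpa using hy)
  have h0 : cfc β (y₀ * star y₀) = 0 := by
    rw [← cfc_zero ℝ (y₀ * star y₀)]
    refine cfc_congr fun s hs ↦ ?_
    rcases le_or_eq_one_of_gap hy h hs with h1 | rfl
    · exact max_eq_left (mul_nonpos_of_nonpos_of_nonneg (by linarith) (by linarith))
    · simp [hβ]
  have hpos : ‖cfc β (y₀ * star y₀)‖ < 2 / 9 * (1 - r) ^ 2 := by
    rw [h0, norm_zero]
    have : 0 < 1 - r := by linarith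
    positivity
  filter_upwards [hc.eventually_lt_const hpos] with y hlt
  refine isStarProjection_leftCutoff hr fun s hs ↦ le_or_le_of_gap_bump_lt ?_
  calc β s ≤ ‖β s‖ := le_abs_self _
    _ ≤ ‖cfc β (y * star y)‖ :=
      norm_apply_le_norm_cfc β _ hs hβc.continuousOn (IsSelfAdjoint.mul_star_self y)
    _ < _ := hlt

theorem norm_leftCutoff_mul_lt_one {r : ℝ} (hr0 : 0 ≤ r) (hr : r < 1) {y : B} (hy : ‖y‖ ≤ 1)
    (h : ∀ s ∈ spectrum ℝ (y * star y), s < 1 → s ≤ r) : ‖leftCutoff r y * y‖ < 1 := by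
  have hsq : ‖leftCutoff r y * y‖ * ‖leftCutoff r y * y‖ ≤ r := by
    have hk : IsSelfAdjoint (leftCutoff r y) := cfc_predicate _ _
    have hc := continuous_gapCutoff r
    have he : leftCutoff r y * y * star (leftCutoff r y * y) =
        cfc (fun s ↦ gapCutoff r s * s * gapCutoff r s) (y * star y) := by
      rw [cfc_mul (fun s ↦ gapCutoff r s * s) (gapCutoff r) (y * star y)
        (hc.mul continuous_id).continuousOn hc.continuousOn,
        cfc_mul (gapCutoff r) (fun s ↦ s) (y * star y) hc.continuousOn, cfc_id' ℝ (y * star y),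
        star_mul, hk.star_eq]
      simp only [leftCutoff, mul_assoc]
    rw [← CStarRing.norm_self_mul_star, he]
    refine norm_cfc_le hr0 fun s hs ↦ ?_
    have hs0 := (spectrum_mul_star_self_subset_Icc hy hs).1
    rcases le_or_eq_one_of_gap hy h hs with h1 | h1
    · rw [gapCutoff_eq_one hr (by linarith)]
      simpa [abs_of_nonneg hs0] using h1
    · rw [gapCutoff_eq_zero hr (by linarith)]
      simpa using hr0
  nlinarith [norm_nonneg (leftCutoff r y * y)]

/-- The complement of the cutoff lives on the eigenvalue 1 of x₀x₀*, so it annihilates 1 - x₀x₀*. -/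
theorem leftCutoff_mul_sub_convex_combination {r : ℝ} (hr : r < 1) {n : ℕ} {x : Fin n → B}
    {l : Fin n → ℝ} (hx : ∀ i, ‖x i‖ ≤ 1) (hl : ∀ i, 0 < l i) (hsum : ∑ i, l i = 1)
    (hx₀ : ‖∑ j, l j • x j‖ ≤ 1)
    (h : ∀ s ∈ spectrum ℝ ((∑ j, l j • x j) * star (∑ j, l j • x j)), s < 1 → s ≤ r) (i : Fin n) :
    leftCutoff r (∑ j, l j • x j) * (x i - ∑ j, l j • x j) = x i - ∑ j, l j • x j := by
  have key := mul_sub_convex_combination_eq_zero (p := 1 - leftCutoff r (∑ j, l j • x j))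
    hx hl hsum ?_ i
  · rw [sub_mul, one_mul, sub_eq_zero] at key
    exact key.symm
  · generalize ∑ j, l j • x j = y at *
    have hp := (isStarProjection_leftCutoff_of_gap hr hx₀ h).one_sub
    have hc := continuous_gapCutoff r
    have h1 : 1 - leftCutoff r y = cfc (fun s ↦ 1 - gapCutoff r s) (y * star y) := by
      rw [cfc_sub (fun _ ↦ 1) (gapCutoff r) (y * star y) continuousOn_const hc.continuousOn,
        cfc_const_one ℝ (y * star y), leftCutoff]
    have h2 : 1 - y * star y = cfc (fun s : ℝ ↦ 1 - s) (y * star y) := by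
      rw [cfc_sub (fun _ ↦ 1) (fun s ↦ s) (y * star y),
        cfc_const_one ℝ (y * star y), cfc_id' ℝ (y * star y)]
    have h3 : (1 - leftCutoff r y) * (1 - y * star y) = 0 := by
      rw [h1, h2, ← cfc_mul _ _ (y * star y) (by fun_prop) (by fun_prop),
        ← cfc_zero ℝ (y * star y)]
      refine cfc_congr fun s hs ↦ ?_
      rcases le_or_eq_one_of_gap hx₀ h hs with h1 | h1
      · simp [gapCutoff_eq_one hr (show s ≤ (2 * r + 1) / 3 by linarith)]
      · simp [h1]
    rw [h3, zero_mul]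

theorem exists_two_sided_correction [FiniteDimensional ℂ B] {n : ℕ} {x : Fin n → B}
    {l : Fin n → ℝ} (hx : ∀ i, ‖x i‖ ≤ 1) (hl : ∀ i, 0 < l i) (hsum : ∑ i, l i = 1)
    {t : ℝ} (ht0 : 0 < t) (ht1 : t ≤ 1) :
    ∃ K H : B → B, ContinuousOn K (closedBall 0 1) ∧ ContinuousOn H (closedBall 0 1) ∧
      (∀ i, K (∑ j, l j • x j) * (x i - ∑ j, l j • x j) * H (∑ j, l j • x j) =
        x i - ∑ j, l j • x j) ∧
      ∀ᶠ y in 𝓝[closedBall 0 1] (∑ j, l j • x j), ∀ i,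
        ‖y + K y * ((1 - t) • (x i - ∑ j, l j • x j)) * H y‖ ≤ 1 := by
  have hx₀ : ‖∑ j, l j • x j‖ ≤ 1 := by
    refine (norm_sum_le _ _).trans (hsum ▸ Finset.sum_le_sum fun j _ ↦ ?_)
    rw [norm_smul, Real.norm_of_nonneg (hl j).le]
    exact mul_le_of_le_one_right (hl j).le (hx j)
  have hstar : star (∑ j, l j • x j) = ∑ j, l j • star (x j) := by simp [star_sum, star_smul]
  have : FiniteDimensional ℝ B := FiniteDimensional.complexToReal B
  -- One r serves both products: the intertwining K(y)y = yH(y) needs the same cutoff on each side.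
  obtain ⟨r, hr0, hr, hgap⟩ := Set.Finite.exists_gap_below_one
    ((spectrum.finite_of_finiteDimensional (K := ℝ)
      ((∑ j, l j • x j) * star (∑ j, l j • x j))).union
    (spectrum.finite_of_finiteDimensional (K := ℝ)
      (star (∑ j, l j • x j) * star (star (∑ j, l j • x j)))))
  have hL := fun s hs ↦ hgap s (Or.inl hs)
  have hR := fun s hs ↦ hgap s (Or.inr hs)
  have hxs : ∀ i, ‖star (x i)‖ ≤ 1 := fun i ↦ (norm_star _).trans_le (hx i)
  have hx₀s : ‖star (∑ j, l j • x j)‖ ≤ 1 := (norm_star _).trans_le hx₀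
  have hKw := leftCutoff_mul_sub_convex_combination hr hx hl hsum hx₀ hL
  have hHw : ∀ i, (x i - ∑ j, l j • x j) * leftCutoff r (star (∑ j, l j • x j)) =
      x i - ∑ j, l j • x j := by
    intro i
    have h1 := leftCutoff_mul_sub_convex_combination hr hxs hl hsum (by rwa [← hstar])
      (by rwa [← hstar]) i
    rw [← hstar, ← star_sub] at h1
    have h2 := congrArg star h1
    have h3 : IsSelfAdjoint (leftCutoff r (star (∑ j, l j • x j))) := cfc_predicate _ _
    rwa [star_mul, star_star, h3.star_eq] at h2
  have hK₀ := isStarProjection_leftCutoff_of_gap hr hx₀ hL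
  have hH₀ := isStarProjection_leftCutoff_of_gap hr hx₀s hR
  have hlt := norm_leftCutoff_mul_lt_one hr0 hr hx₀ hL
  have hKc := continuousOn_leftCutoff (B := B) r
  have hHc := continuousOn_leftCutoff_star (B := B) r
  have hKe := eventually_isStarProjection_leftCutoff hr hx₀ hL
  have htend : Tendsto star (𝓝[closedBall 0 1] (∑ j, l j • x j))
      (𝓝[closedBall 0 1] (star (∑ j, l j • x j))) :=
    tendsto_nhdsWithin_iff.2 ⟨(continuous_star.tendsto _).mono_left nhdsWithin_le_nhds,
      eventually_mem_nhdsWithin.mono fun y hy ↦ by simpa using hy⟩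
  have hHe := htend.eventually (eventually_isStarProjection_leftCutoff hr hx₀s hR)
  refine ⟨leftCutoff r, fun y ↦ leftCutoff r (star y), hKc, hHc,
    fun i ↦ by rw [hKw, hHw], ?_⟩
  have hcomm := leftCutoff_mul r (∑ j, l j • x j)
  have hmem : ∑ j, l j • x j ∈ closedBall (0 : B) 1 := by simpa using hx₀
  generalize ∑ j, l j • x j = x₀ at *
  have hcorner : ∀ i, ∀ᶠ y in 𝓝[closedBall 0 1] x₀, ‖leftCutoff r y * y * leftCutoff r (star y) +
      leftCutoff r y * ((1 - t) • (x i - x₀)) * leftCutoff r (star y)‖ < 1 := by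
    intro i
    have hc : ContinuousOn (fun y ↦ ‖leftCutoff r y * y * leftCutoff r (star y) +
      leftCutoff r y * ((1 - t) • (x i - x₀)) * leftCutoff r (star y)‖) (closedBall 0 1) :=
      (((hKc.mul continuousOn_id).mul hHc).add ((hKc.mul continuousOn_const).mul hHc)).norm
    refine (hc x₀ hmem).eventually_lt_const ?_
    have h1 : leftCutoff r x₀ * x₀ * leftCutoff r (star x₀) = leftCutoff r x₀ * x₀ := by
      rw [hcomm, mul_assoc, hH₀.isIdempotentElem.eq]
    have h2 : leftCutoff r x₀ * ((1 - t) • (x i - x₀)) * leftCutoff r (star x₀) =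
        (1 - t) • (leftCutoff r x₀ * x i * leftCutoff r (star x₀)) -
          (1 - t) • (leftCutoff r x₀ * x₀) := by
      rw [mul_smul_comm, smul_mul_assoc, mul_sub, sub_mul, h1, smul_sub]
    have h3 : ‖leftCutoff r x₀ * x i * leftCutoff r (star x₀)‖ ≤ 1 :=
      calc _ ≤ ‖leftCutoff r x₀‖ * ‖x i‖ * ‖leftCutoff r (star x₀)‖ := norm_mul₃_le
        _ ≤ 1 * 1 * 1 := by
          gcongr
          exacts [hK₀.norm_le, hx i, hH₀.norm_le]
        _ = 1 := by norm_num
    -- At x₀ the moved corner is a convex combination of k x₀, of norm below 1, and the contraction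
    -- k xᵢ h; the weight t > 0 makes the bound strict.
    have h4 : leftCutoff r x₀ * x₀ * leftCutoff r (star x₀) +
        leftCutoff r x₀ * ((1 - t) • (x i - x₀)) * leftCutoff r (star x₀) =
        t • (leftCutoff r x₀ * x₀) +
          (1 - t) • (leftCutoff r x₀ * x i * leftCutoff r (star x₀)) := by
      rw [h2, h1]
      module
    beta_reduce
    rw [h4]
    calc _ ≤ t * ‖leftCutoff r x₀ * x₀‖ +
          (1 - t) * ‖leftCutoff r x₀ * x i * leftCutoff r (star x₀)‖ := by
          refine (norm_add_le _ _).trans_eq ?_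
          rw [norm_smul, norm_smul, Real.norm_of_nonneg ht0.le,
            Real.norm_of_nonneg (sub_nonneg.2 ht1)]
      _ < t * 1 + (1 - t) * 1 :=
          add_lt_add_of_lt_of_le (mul_lt_mul_of_pos_left hlt ht0)
            (mul_le_mul_of_nonneg_left h3 (sub_nonneg.2 ht1))
      _ = 1 := by ring
  filter_upwards [hKe, hHe, eventually_all.2 hcorner, self_mem_nhdsWithin] with y hk hh hw hy i
  exact norm_add_corner_le_one hk hh (leftCutoff_mul r y) (by simpa using hy) (hw i).le

end Correction

/-! ### Descent from the unitization and conclusion -/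

instance Unitization.instFiniteDimensional (A : Type*) [NonUnitalCStarAlgebra A]
    [FiniteDimensional ℂ A] : FiniteDimensional ℂ (Unitization ℂ A) :=
  Module.Finite.equiv (Unitization.linearEquiv ℂ ℂ A).symm

/-- A is a two-sided ideal of its unitization, so corrections built there return to A. -/
theorem Unitization.inr_snd_mul_inr_mul {A : Type*} [NonUnitalCStarAlgebra A]
    (k h : Unitization ℂ A) (w : A) : ((k * (w : Unitization ℂ A) * h).snd : Unitization ℂ A) =
      k * (w : Unitization ℂ A) * h := by
  ext <;> simp

/-- The nonunital version of `exists_two_sided_correction`: the perturbations `W y i` of `y` stay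
in the unit ball, depend continuously on `y` and average to zero. -/
theorem exists_balanced_perturbation {A : Type*} [NonUnitalCStarAlgebra A] [FiniteDimensional ℂ A]
    {n : ℕ} {x : Fin n → A} {l : Fin n → ℝ} (hx : ∀ i, ‖x i‖ ≤ 1) (hl : ∀ i, 0 < l i)
    (hsum : ∑ i, l i = 1) {t : ℝ} (ht0 : 0 < t) (ht1 : t ≤ 1) :
    ∃ W : A → Fin n → A, (∀ i, ContinuousOn (fun y ↦ W y i) (closedBall 0 1)) ∧
      (∀ i, W (∑ j, l j • x j) i = (1 - t) • (x i - ∑ j, l j • x j)) ∧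
      (∀ y, ∑ i, l i • W y i = 0) ∧
      ∀ᶠ y in 𝓝[closedBall 0 1] (∑ j, l j • x j), ∀ i, ‖y + W y i‖ ≤ 1 := by
  let ι : A →ₗ[ℝ] Unitization ℂ A := Unitization.inrHom ℝ ℂ A
  have hι : Isometry ι := Unitization.isometry_inr
  have hnorm : ∀ a, ‖ι a‖ = ‖a‖ := Unitization.norm_inr (𝕜 := ℂ)
  have hmap : ι (∑ j, l j • x j) = ∑ j, l j • ι (x j) := by simp only [map_sum, map_smul]
  obtain ⟨K, H, hK, hH, hfix, hball⟩ := exists_two_sided_correction (x := fun i ↦ ι (x i))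
    (fun i ↦ (hnorm _).trans_le (hx i)) hl hsum ht0 ht1
  rw [← hmap] at hfix hball
  have hmaps : Set.MapsTo ι (closedBall 0 1) (closedBall 0 1) := fun y hy ↦ by
    simpa [hnorm] using hy
  let W : A → Fin n → A := fun y i ↦
    (K (ι y) * ι ((1 - t) • (x i - ∑ j, l j • x j)) * H (ι y)).snd
  have hW : ∀ y i, ι (W y i) = K (ι y) * ι ((1 - t) • (x i - ∑ j, l j • x j)) * H (ι y) :=
    fun y i ↦ Unitization.inr_snd_mul_inr_mul _ _ _
  refine ⟨W, fun i ↦ ?_, fun i ↦ hι.injective ?_, fun y ↦ hι.injective ?_, ?_⟩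
  · rw [hι.isUniformInducing.isInducing.continuousOn_iff]
    refine ContinuousOn.congr ?_ fun y _ ↦ hW y i
    exact ((hK.comp hι.continuous.continuousOn hmaps).mul continuousOn_const).mul
      (hH.comp hι.continuous.continuousOn hmaps)
  · rw [hW, map_smul, map_sub, mul_smul_comm, smul_mul_assoc, hfix]
  · have hmean : ∑ i, l i • ((1 - t) • (x i - ∑ j, l j • x j)) = 0 := by
      simp_rw [smul_comm _ (1 - t), ← Finset.smul_sum, smul_sub, Finset.sum_sub_distrib,
        ← Finset.sum_smul, hsum, one_smul, sub_self, smul_zero]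
    have : ι (∑ i, l i • W y i) =
        K (ι y) * ι (∑ i, l i • ((1 - t) • (x i - ∑ j, l j • x j))) * H (ι y) := by
      simp only [map_sum, map_smul ι (l _), hW, Finset.mul_sum, Finset.sum_mul, mul_smul_comm,
        smul_mul_assoc]
    rw [this, hmean, map_zero, mul_zero, zero_mul]
  · have htend : Tendsto ι (𝓝[closedBall 0 1] (∑ j, l j • x j))
        (𝓝[closedBall 0 1] (ι (∑ j, l j • x j))) :=
      hι.continuous.continuousWithinAt.tendsto_nhdsWithin hmaps
    filter_upwards [htend.eventually hball] with y hy i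
    rw [← hnorm, map_add, hW, map_smul, map_sub]
    exact hy i

theorem mainTheorem5 (A : Type*) [NonUnitalCStarAlgebra A] [FiniteDimensional ℂ A] :
    PropertyCO A := by
  intro n x l ε hx hl hsum hε
  have hx' : ∀ i, ‖x i‖ ≤ 1 := fun i ↦ by simpa using hx i
  have hx₀ : ∑ j, l j • x j ∈ closedBall (0 : A) 1 :=
    (convex_closedBall 0 1).sum_mem (fun i _ ↦ (hl i).le) hsum fun i _ ↦ hx i
  -- With t this minimum, Φᵢ(x₀) misses xᵢ by t‖x₀ - xᵢ‖ ≤ 2t ≤ ε/2, leaving room for continuity.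
  have ht0 : 0 < min 1 (ε / 4) := by positivity
  obtain ⟨W, hWc, hW₀, hWsum, hWball⟩ :=
    exists_balanced_perturbation hx' hl hsum ht0 (min_le_left _ _)
  have htε : min 1 (ε / 4) ≤ ε / 4 := min_le_right _ _
  generalize min 1 (ε / 4) = t at *
  have hΦc : ∀ i, ContinuousOn (fun y ↦ y + W y i) (closedBall 0 1) :=
    fun i ↦ continuousOn_id.add (hWc i)
  have hnear : ∀ i, ∀ᶠ y in 𝓝[closedBall 0 1] (∑ j, l j • x j), y + W y i ∈ ball (x i) ε := by
    intro i
    refine (hΦc i _ hx₀).eventually_mem (isOpen_ball.mem_nhds ?_)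
    have h1 : (∑ j, l j • x j) + W (∑ j, l j • x j) i - x i = t • ((∑ j, l j • x j) - x i) := by
      rw [hW₀]
      module
    have h2 : ‖(∑ j, l j • x j) - x i‖ ≤ 2 := by
      linarith [norm_sub_le (∑ j, l j • x j) (x i), hx' i, mem_closedBall_zero_iff.1 hx₀]
    rw [mem_ball, dist_eq_norm, h1, norm_smul, Real.norm_of_nonneg ht0.le]
    nlinarith
  obtain ⟨δ, hδ, hsub⟩ :=
    mem_nhdsWithin_iff.1 (hWball.and (eventually_all.2 hnear))
  refine ⟨δ, hδ, fun i y ↦ y + W y i, fun i ↦ (hΦc i).mono Set.inter_subset_right,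
    fun i y hy ↦ ⟨(hsub hy).2 i, mem_closedBall_zero_iff.2 ((hsub hy).1 i)⟩, fun y _ ↦ ?_⟩
  rw [Finset.sum_congr rfl fun i _ ↦ smul_add _ _ _, Finset.sum_add_distrib, hWsum,
    ← Finset.sum_smul, hsum, one_smul, add_zero]
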